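/- There is an absolute constant $C>0$ such that the following holds. Let $\mathcal T$ be a set of $n\ge 1$ tasks, let $\Gamma_1,\dots,\Gamma_l\subseteq\mathcal T$ be task subsets such that every task lies in at least two of them, and let $1,\dots,m$ ($m\ge 1$) be workers with costs $c_i\in[1,b_{\max}]$ who bid truthfully ($b_i=c_i$). Matching: a matching result $\mathcal P$ assigns to each $\Gamma_j$, independently, a worker $w(j)$, where worker $i$ is chosen with probability $\exp\!\big(\tfrac{\epsilon u(c_i)}{2\Delta u}\big)\big/\sum_{i'}\exp\!\big(\tfrac{\epsilon u(c_{i'})}{2\Delta u}\big)$; here $u$ is any score function, and $\Delta u>0$ and $\epsilon>0$ are any constants. Arrivals: for $k\ge 1$ let $\mathcal A$ consist of $k$ tasks drawn independently and uniformly at random from $\mathcal T$ (repetitions are possible), and let $C_{\mathcal{OPT}}(\mathcal A,W)$ be the minimum of $\sum_{j\in F}c_{w(j)}$ over all $F\subseteq\{1,\dots,l\}$ such that $\mathcal A\subseteq\bigcup_{j\in F}\Gamma_j$. Winning selection of HERALD*: given $\mathcal P$ and $k$, put $T=64\,\mathbb E[C_{\mathcal{OPT}}(\mathcal A,W)]$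 and start with the set $U=\mathcal T$ of uncollected tasks and with all matching pairs. While $U\ne\emptyset$, consider the remaining pairs with $\Gamma_j\cap U\neq\emptyset$. If some of them satisfy $c_{w(j)}/|\Gamma_j\cap U|\le T/|U|$, select one with minimum $c_{w(j)}/|\Gamma_j\cap U|$ (type I); otherwise select one with minimum $c_{w(j)}$ (type II). Remove the selected pair, and replace $U$ by $U\setminus\Gamma_j$. Ties are broken arbitrarily. Let $\mathcal S(\mathcal A,W)$ be the set of the winning pairs that serve $\mathcal A$, each task being served by the first selected pair whose subset contains it, and let $C(\mathcal S(\mathcal A,W))$ be the sum of the costs of these pairs. Then the competitive ratio of HERALD* on expected social cost satisfies $$\sup_{k\ge 1}\ \mathbb E_{\mathcal P}\!\left[\frac{\mathbb E_{\mathcal A}[C(\mathcal S(\mathcal A,W))]}{\mathbb E_{\mathcal A}[C_{\mathcal{OPT}}(\mathcal A,W)]}\right]\le C\ln(l\,n),$$ and the same bound holds if the expectation over $\mathcal P$ is conditioned on the event that every task is matched by at least two different workers, provided that some matching result has this property. -/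

import Mathlib

open Finset

namespace Herald

/-! Tasks are `Fin n`, workers are `Fin m`, and the task subsets are `Γ 0, …, Γ (l - 1)`.
A matching result assigns a worker `P j` to each task subset `Γ j`; it stands for the set of
matching pairs `(Γ j, c (P j))`.  Workers bid their true costs `c`. -/

variable {n m l : ℕ}

section Matching

/-- Probability that a given task subset is matched with worker `i`: the exponential mechanism
with score function `u`, sensitivity `Δ` and privacy parameter `ε`. -/
noncomputable def workerProb (u : ℝ → ℝ) (Δ ε : ℝ) (c : Fin m → ℝ) (i : Fin m) : ℝ :=
  Real.exp (ε * u (c i) / (2 * Δ)) / ∑ i' : Fin m, Real.exp (ε * u (c i') / (2 * Δ))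

/-- Probability of the matching result `P`: the task subsets are matched independently. -/
noncomputable def matchingProb (u : ℝ → ℝ) (Δ ε : ℝ) (c : Fin m → ℝ) (P : Fin l → Fin m) : ℝ :=
  ∏ j : Fin l, workerProb u Δ ε c (P j)

/-- The matching results in which each task is matched by at least two different workers. -/
def adequateMatchings (Γ : Fin l → Finset (Fin n)) (m : ℕ) : Finset (Fin l → Fin m) :=
  univ.filter fun P => ∀ t : Fin n, ∃ j₁ j₂ : Fin l, t ∈ Γ j₁ ∧ t ∈ Γ j₂ ∧ P j₁ ≠ P j₂

end Matching

section Requests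

/-- Expectation of `f 𝒜` when `𝒜` consists of `k` tasks that arrive independently and uniformly
at random (repetitions are possible). -/
noncomputable def expectArrival (n k : ℕ) (f : (Fin k → Fin n) → ℝ) : ℝ :=
  (∑ A : Fin k → Fin n, f A) / (n : ℝ) ^ k

/-- The minimum social cost of the requested tasks `A`: the least total cost of a set of matching
pairs whose task subsets cover `A`, where `w j` is the cost of the worker matched to `Γ j`. -/
noncomputable def optCost (Γ : Fin l → Finset (Fin n)) (w : Fin l → ℝ) {k : ℕ}
    (A : Fin k → Fin n) : ℝ :=
  sInf {x : ℝ | ∃ F : Finset (Fin l), (∀ r, ∃ j ∈ F, A r ∈ Γ j) ∧ x = ∑ j ∈ F, w j}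

/-- The expected minimum social cost of `k` uniformly arriving tasks. -/
noncomputable def expectedOpt (Γ : Fin l → Finset (Fin n)) (w : Fin l → ℝ) (k : ℕ) : ℝ :=
  expectArrival n k (optCost Γ w)

end Requests

section Selection

/-- Cost-effectiveness of the pair `j` when the tasks in `U` are not collected yet. It is used
only for pairs with `Γ j ∩ U ≠ ∅`. -/
noncomputable def costEff (Γ : Fin l → Finset (Fin n)) (w : Fin l → ℝ) (U : Finset (Fin n))
    (j : Fin l) : ℝ :=
  w j / ((Γ j ∩ U).card : ℝ)

/-- The pair `j` is in the current matching set `Q` and its subset contains an uncollected task. -/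
def Useful (Γ : Fin l → Finset (Fin n)) (U : Finset (Fin n)) (Q : Finset (Fin l))
    (j : Fin l) : Prop :=
  j ∈ Q ∧ (Γ j ∩ U).Nonempty

/-- The pair `j` is a candidate for type I selection with threshold `T`. -/
def TypeICandidate (Γ : Fin l → Finset (Fin n)) (w : Fin l → ℝ) (T : ℝ) (U : Finset (Fin n))
    (Q : Finset (Fin l)) (j : Fin l) : Prop :=
  Useful Γ U Q j ∧ costEff Γ w U j ≤ T / (U.card : ℝ)

/-- The pair `j` may be selected in an iteration that starts with uncollected tasks `U` and
matching set `Q`: type I selection if there is a candidate for it, type II selection otherwise.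
Ties may be broken in any way. -/
def Selects (Γ : Fin l → Finset (Fin n)) (w : Fin l → ℝ) (T : ℝ) (U : Finset (Fin n))
    (Q : Finset (Fin l)) (j : Fin l) : Prop :=
  (TypeICandidate Γ w T U Q j ∧
      ∀ j', TypeICandidate Γ w T U Q j' → costEff Γ w U j ≤ costEff Γ w U j') ∨
    ((¬ ∃ j', TypeICandidate Γ w T U Q j') ∧ Useful Γ U Q j ∧ ∀ j', Useful Γ U Q j' → w j ≤ w j')

/-- `IsRun Γ w T U Q L`: started with uncollected tasks `U` and matching set `Q`, the winning
selection loop with threshold `T` can select exactly the pairs in the list `L`, in this order. -/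
inductive IsRun (Γ : Fin l → Finset (Fin n)) (w : Fin l → ℝ) (T : ℝ) :
    Finset (Fin n) → Finset (Fin l) → List (Fin l) → Prop
  | done (Q : Finset (Fin l)) : IsRun Γ w T ∅ Q []
  | step {U : Finset (Fin n)} {Q : Finset (Fin l)} {j : Fin l} {L : List (Fin l)} :
      U.Nonempty → Selects Γ w T U Q j → IsRun Γ w T (U \ Γ j) (Q.erase j) L →
        IsRun Γ w T U Q (j :: L)

/-- The winning pairs used for the requested tasks `A`, where `L` lists the winning pairs in the
order of their selection: each task is served by the pair with which its data was collected,
that is, the first pair in `L` whose subset contains it. -/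
def winningSet (Γ : Fin l → Finset (Fin n)) (L : List (Fin l)) {k : ℕ} (A : Fin k → Fin n) :
    Finset (Fin l) :=
  univ.filter fun j => ∃ r : Fin k, L.find? (fun j' => decide (A r ∈ Γ j')) = some j

/-- The social cost of the winning pairs used for the requested tasks `A`. -/
def socialCost (Γ : Fin l → Finset (Fin n)) (w : Fin l → ℝ) (L : List (Fin l)) {k : ℕ}
    (A : Fin k → Fin n) : ℝ :=
  ∑ j ∈ winningSet Γ L A, w j

/-- `run k P` is, for every number `k ≥ 1` of arriving tasks and every matching result `P`, the
outcome of the winning selection loop with selection threshold `64 · 𝔼[C_OPT]`. -/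
def IsWinningSelection (Γ : Fin l → Finset (Fin n)) (c : Fin m → ℝ)
    (run : ℕ → (Fin l → Fin m) → List (Fin l)) : Prop :=
  ∀ k : ℕ, 1 ≤ k → ∀ P : Fin l → Fin m,
    IsRun Γ (fun j => c (P j)) (64 * expectedOpt Γ (fun j => c (P j)) k) univ univ (run k P)

end Selection

section Ratio

/-- `𝔼[C(S(𝒜))] / 𝔼[C_OPT(𝒜)]` for `k` uniformly arriving tasks, where `w` gives the costs of the
matching pairs and `L` the winning pairs. -/
noncomputable def costRatio (Γ : Fin l → Finset (Fin n)) (w : Fin l → ℝ) (L : List (Fin l))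
    (k : ℕ) : ℝ :=
  expectArrival n k (socialCost Γ w L) / expectedOpt Γ w k

/-- Expectation of the cost ratio over the random matching result, conditioned to lie in `F`
(with `F = univ` there is no conditioning). -/
noncomputable def expectedRatio (u : ℝ → ℝ) (Δ ε : ℝ) (Γ : Fin l → Finset (Fin n))
    (c : Fin m → ℝ) (run : ℕ → (Fin l → Fin m) → List (Fin l)) (F : Finset (Fin l → Fin m))
    (k : ℕ) : ℝ :=
  (∑ P ∈ F, matchingProb u Δ ε c P * costRatio Γ (fun j => c (P j)) (run k P) k) /
    ∑ P ∈ F, matchingProb u Δ ε c P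

/-- The competitive ratio on expected social cost: the supremum of the expected ratio over all
numbers `k ≥ 1` of arriving tasks. -/
noncomputable def competitiveRatio (u : ℝ → ℝ) (Δ ε : ℝ) (Γ : Fin l → Finset (Fin n))
    (c : Fin m → ℝ) (run : ℕ → (Fin l → Fin m) → List (Fin l))
    (F : Finset (Fin l → Fin m)) : EReal :=
  ⨆ k : ℕ, ⨆ _ : 1 ≤ k, ((expectedRatio u Δ ε Γ c run F k : ℝ) : EReal)

end Ratio

end Herald

/-! The bound holds for every single matching result, so the exponential mechanism plays no role: a
weighted average of ratios below `160 * log (l * n)` stays below it (`competitiveRatio_le`). Fix a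
matching, let `μ` be the expected optimum, and write `κ(U) = k|U|/n` for the expected number of
requests in `U`. Type I costs telescope as in greedy set cover, to at most `64 μ (1 + log n)`. For
type II, the main estimate `mul_card_div_le_expectArrival_card_meeting` says that if no pair is
cost-effective on `U`, then `κ(U)` is at most `16 log (l + 1)` times the expected number of optimal
sets meeting `U`. Few sets of bounded total cost cover only a small part of `U`, and a union bound
over small families shows that they rarely catch all requests in `U`. Type II prices never decrease,
so `expectArrival_costWithin_le` charges each price increase to the optimal sets still meeting `U`,
all of which cost at least the new price. -/

namespace Herald

/-! ### Uniform arrivals: hitting probabilities and exponential bounds -/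

section Expectation

variable {n k : ℕ}

lemma expectArrival_mono {f g : (Fin k → Fin n) → ℝ} (h : ∀ A, f A ≤ g A) :
    expectArrival n k f ≤ expectArrival n k g := by
  unfold expectArrival
  gcongr with A _
  exact h A

lemma expectArrival_add (f g : (Fin k → Fin n) → ℝ) :
    expectArrival n k (fun A => f A + g A) = expectArrival n k f + expectArrival n k g := by
  simp only [expectArrival, Finset.sum_add_distrib, add_div]

lemma expectArrival_const_mul (a : ℝ) (f : (Fin k → Fin n) → ℝ) :
    expectArrival n k (fun A => a * f A) = a * expectArrival n k f := by
  simp only [expectArrival, ← Finset.mul_sum, mul_div_assoc]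

lemma expectArrival_sum {ι : Type*} (s : Finset ι) (f : ι → (Fin k → Fin n) → ℝ) :
    expectArrival n k (fun A => ∑ i ∈ s, f i A) = ∑ i ∈ s, expectArrival n k (f i) := by
  simp only [expectArrival, Finset.sum_div]
  rw [Finset.sum_comm]

lemma expectArrival_const (hn : 1 ≤ n) (a : ℝ) : expectArrival n k (fun _ => a) = a := by
  have : (n : ℝ) ^ k ≠ 0 := by positivity
  simp only [expectArrival, Finset.sum_const, Finset.card_univ, Fintype.card_fun,
    Fintype.card_fin, nsmul_eq_mul, Nat.cast_pow]
  field_simp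

lemma expectArrival_forall_mem (V : Finset (Fin n)) :
    expectArrival n k (fun A => if ∀ r, A r ∈ V then 1 else 0) = ((V.card : ℝ) / n) ^ k := by
  have h : (univ.filter fun A : Fin k → Fin n => ∀ r, A r ∈ V) = Fintype.piFinset fun _ => V := by
    ext A; simp
  simp only [expectArrival, Finset.sum_boole, h, Fintype.card_piFinset_const, Nat.cast_pow,
    div_pow]

lemma expectArrival_exists_mem (hn : 1 ≤ n) (V : Finset (Fin n)) :
    expectArrival n k (fun A => if ∃ r, A r ∈ V then 1 else 0)
      = 1 - (1 - (V.card : ℝ) / n) ^ k := by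
  have hn0 : (n : ℝ) ≠ 0 := by positivity
  have hcard : ((Vᶜ.card : ℕ) : ℝ) = n - V.card := by
    rw [Finset.card_compl, Fintype.card_fin, Nat.cast_sub]
    simpa using Finset.card_le_univ V
  have h1 := expectArrival_forall_mem (k := k) Vᶜ
  have h2 : expectArrival n k (fun A => (if ∃ r, A r ∈ V then (1 : ℝ) else 0) +
      (if ∀ r, A r ∈ Vᶜ then 1 else 0)) = 1 := by
    refine Eq.trans ?_ (expectArrival_const (k := k) hn 1)
    congr 1
    funext A
    by_cases h : ∃ r, A r ∈ V
    · have : ¬ ∀ r, A r ∈ Vᶜ := by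
        obtain ⟨r, hr⟩ := h
        intro h'
        exact (Finset.mem_compl.1 (h' r)) hr
      rw [if_pos h, if_neg this, add_zero]
    · have h' : ∀ r, A r ∈ Vᶜ := fun r => Finset.mem_compl.2 fun hr => h ⟨r, hr⟩
      rw [if_neg h, if_pos h', zero_add]
  rw [expectArrival_add, h1, hcard, sub_div, div_self hn0] at h2
  linarith

lemma card_div_le_one (V : Finset (Fin n)) : (V.card : ℝ) / n ≤ 1 := by
  apply div_le_one_of_le₀ _ (by positivity)
  exact_mod_cast (by simpa using Finset.card_le_univ V : V.card ≤ n)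

lemma expectArrival_exists_mem_le (hn : 1 ≤ n) (V : Finset (Fin n)) :
    expectArrival n k (fun A => if ∃ r, A r ∈ V then 1 else 0) ≤ k * V.card / n := by
  rw [expectArrival_exists_mem hn]
  have h := one_add_mul_le_pow (a := -((V.card : ℝ) / n))
    (by linarith [card_div_le_one V]) k
  rw [← sub_eq_add_neg] at h
  have : (k : ℝ) * V.card / n = k * (V.card / n) := by ring
  linarith

lemma one_sub_pow_le_exp_neg_mul {p : ℝ} (hp : p ≤ 1) (k : ℕ) :
    (1 - p) ^ k ≤ Real.exp (-(k * p)) := by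
  calc (1 - p) ^ k ≤ Real.exp (-p) ^ k :=
        pow_le_pow_left₀ (by linarith) (Real.one_sub_le_exp_neg p) k
    _ = Real.exp (-(k * p)) := by rw [← Real.exp_nat_mul]; ring_nf

lemma exp_neg_le_inv_one_add {x : ℝ} (hx : 0 ≤ x) : Real.exp (-x) ≤ 1 / (1 + x) := by
  rw [Real.exp_neg, ← one_div]
  exact one_div_le_one_div_of_le (by linarith) (by linarith [Real.add_one_le_exp x])

end Expectation

/-! ### Optimal covers when no pair is cost-effective -/

section Optimum

variable {n l k : ℕ}

lemma exists_optCost_eq {Γ : Fin l → Finset (Fin n)} (hΓ : ∀ t, ∃ j, t ∈ Γ j)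
    (w : Fin l → ℝ) (A : Fin k → Fin n) :
    ∃ F : Finset (Fin l), (∀ r, ∃ j ∈ F, A r ∈ Γ j) ∧ ∑ j ∈ F, w j = optCost Γ w A := by
  have hfin : {x : ℝ | ∃ F : Finset (Fin l), (∀ r, ∃ j ∈ F, A r ∈ Γ j) ∧
      x = ∑ j ∈ F, w j}.Finite := by
    refine (Set.finite_range fun F : Finset (Fin l) => ∑ j ∈ F, w j).subset ?_
    rintro x ⟨F, -, rfl⟩
    exact ⟨F, rfl⟩
  have hne : {x : ℝ | ∃ F : Finset (Fin l), (∀ r, ∃ j ∈ F, A r ∈ Γ j) ∧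
      x = ∑ j ∈ F, w j}.Nonempty := by
    refine ⟨_, univ, fun r => ?_, rfl⟩
    obtain ⟨j, hj⟩ := hΓ (A r)
    exact ⟨j, mem_univ j, hj⟩
  obtain ⟨F, hF, h⟩ := hne.csInf_mem hfin
  exact ⟨F, hF, h.symm⟩

lemma one_le_optCost {Γ : Fin l → Finset (Fin n)} (hΓ : ∀ t, ∃ j, t ∈ Γ j)
    {w : Fin l → ℝ} (hw : ∀ j, 1 ≤ w j) (hk : 1 ≤ k) (A : Fin k → Fin n) :
    1 ≤ optCost Γ w A := by
  obtain ⟨F, hF, h⟩ := exists_optCost_eq hΓ w A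
  obtain ⟨j, hj, -⟩ := hF ⟨0, hk⟩
  rw [← h]
  exact (hw j).trans (single_le_sum (f := w) (fun i _ => by linarith [hw i]) hj)

lemma one_le_expectedOpt (hn : 1 ≤ n) {Γ : Fin l → Finset (Fin n)} (hΓ : ∀ t, ∃ j, t ∈ Γ j)
    {w : Fin l → ℝ} (hw : ∀ j, 1 ≤ w j) (hk : 1 ≤ k) : 1 ≤ expectedOpt Γ w k := by
  rw [← expectArrival_const (k := k) hn 1]
  exact expectArrival_mono fun A => one_le_optCost hΓ hw hk A

/-- The sets of `F` that contain a task of `U`. -/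
def meeting (Γ : Fin l → Finset (Fin n)) (U : Finset (Fin n)) (F : Finset (Fin l)) :
    Finset (Fin l) :=
  F.filter fun j => (Γ j ∩ U).Nonempty

/-- A set of at most `M` indices is the range of a map from `Fin M` to `Option (Fin l)`, with `none`
as padding. -/
lemma card_filter_card_le (l M : ℕ) :
    (univ.filter fun G : Finset (Fin l) => G.card ≤ M).card ≤ (l + 1) ^ M := by
  classical
  have hcard : (univ : Finset (Fin M → Option (Fin l))).card = (l + 1) ^ M := by simp
  rw [← hcard]
  refine Finset.card_le_card_of_surjOn
    (fun g : Fin M → Option (Fin l) => univ.filter fun j => ∃ i, g i = some j) ?_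
  intro G hG
  have hG : G.card ≤ M := by simpa using hG
  refine ⟨fun i => G.toList[i.1]?, by simp, ?_⟩
  ext j
  simp only [mem_filter, mem_univ, true_and]
  rw [← Finset.mem_toList, List.mem_iff_getElem?]
  constructor
  · rintro ⟨i, hi⟩
    exact ⟨i, hi⟩
  · rintro ⟨i, hi⟩
    have : i < G.toList.length := (List.getElem?_eq_some_iff.1 hi).1
    rw [Finset.length_toList] at this
    exact ⟨⟨i, by omega⟩, hi⟩

/-- If no set is cost-effective on `U`, an optimal cover needs many sets meeting `U`. -/
lemma mul_card_div_le_expectArrival_card_meeting (hn : 1 ≤ n) (hl : 2 ≤ l)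
    {Γ : Fin l → Finset (Fin n)} {w : Fin l → ℝ} (hw : ∀ j, 0 ≤ w j)
    {opt : (Fin k → Fin n) → Finset (Fin l)} (hcov : ∀ A r, ∃ j ∈ opt A, A r ∈ Γ j)
    (hopt : ∀ A, ∑ j ∈ opt A, w j = optCost Γ w A) (hμ : 0 < expectedOpt Γ w k)
    {U : Finset (Fin n)} (hU : U.Nonempty)
    (hineff : ∀ j, (Γ j ∩ U).Nonempty →
      64 * expectedOpt Γ w k / (U.card : ℝ) < costEff Γ w U j) :
    (k : ℝ) * U.card / n ≤ 16 * Real.log (l + 1) *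
      expectArrival n k (fun A => ((meeting Γ U (opt A)).card : ℝ)) := by
  classical
  set μ := expectedOpt Γ w k with hμdef
  set EN := expectArrival n k (fun A => ((meeting Γ U (opt A)).card : ℝ)) with hEN
  have hEN0 : 0 ≤ EN := by
    rw [hEN, ← expectArrival_const (k := k) hn 0]
    exact expectArrival_mono fun A => by positivity
  have hn0 : (0 : ℝ) < n := by exact_mod_cast hn
  have hu0 : (0 : ℝ) < U.card := by exact_mod_cast hU.card_pos
  set p : ℝ := (U.card : ℝ) / n with hp
  have hp1 : p ≤ 1 := card_div_le_one U
  have hp0 : 0 < p := by positivity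
  set κ : ℝ := k * p with hκ
  have hκ0 : 0 ≤ κ := by positivity
  have hgoal : (k : ℝ) * U.card / n = κ := by rw [hκ, hp]; ring
  have hlog : 1 ≤ Real.log (l + 1) := by
    rw [Real.le_log_iff_exp_le (by positivity)]
    have : (2 : ℝ) ≤ l := by exact_mod_cast hl
    linarith [Real.exp_one_lt_three]
  have hmem : ∀ A r, A r ∈ U → ∃ j ∈ meeting Γ U (opt A), A r ∈ Γ j := by
    intro A r hr
    obtain ⟨j, hj, hjr⟩ := hcov A r
    exact ⟨j, mem_filter.2 ⟨hj, A r, mem_inter.2 ⟨hjr, hr⟩⟩, hjr⟩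
  rw [hgoal]
  -- For small `κ` it suffices that an optimal cover meets `U` whenever a request falls in `U`,
  -- which has probability at least `κ / 2`.
  rcases le_or_gt κ 1 with hκ1 | hκ1
  · have h1 : 1 - (1 - p) ^ k ≤ EN := by
      rw [← expectArrival_exists_mem hn]
      refine expectArrival_mono fun A => ?_
      split_ifs with h
      · obtain ⟨r, hr⟩ := h
        obtain ⟨j, hj, -⟩ := hmem A r hr
        exact_mod_cast Finset.card_pos.2 ⟨j, hj⟩
      · positivity
    have h2 : 1 - 1 / (1 + κ) ≤ EN := by
      linarith [one_sub_pow_le_exp_neg_mul hp1 k, exp_neg_le_inv_one_add hκ0]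
    have h3 : κ / 2 ≤ 1 - 1 / (1 + κ) := by
      have : 1 - 1 / (1 + κ) = κ / (1 + κ) := by field_simp; ring
      rw [this]
      exact div_le_div_of_nonneg_left hκ0 (by linarith) (by linarith)
    nlinarith
  -- `M` is chosen so that there are at most `(l + 1) ^ M ≤ exp (κ / 4)` families of at most `M`
  -- sets, few enough to survive a union bound against `exp (-(7 / 8 * κ))`.
  · set M : ℕ := ⌊κ / (4 * Real.log (l + 1))⌋₊ with hM
    have hMle : (M : ℝ) * Real.log (l + 1) ≤ κ / 4 := by
      have h := Nat.floor_le (a := κ / (4 * Real.log (l + 1))) (by positivity)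
      rw [← hM, le_div_iff₀ (by positivity)] at h
      linarith
    have hMlt : κ < 4 * Real.log (l + 1) * (M + 1) := by
      have h := Nat.lt_floor_add_one (κ / (4 * Real.log (l + 1)))
      rw [← hM, div_lt_iff₀ (by positivity)] at h
      linarith
    set V : Finset (Fin l) → Finset (Fin n) := fun G => G.biUnion fun j => Γ j ∩ U with hV
    set 𝒢 : Finset (Finset (Fin l)) :=
      univ.filter fun G => G.card ≤ M ∧ ((V G).card : ℝ) ≤ U.card / 8 with h𝒢
    -- One of three events always occurs: more than `M` optimal sets meet `U`, the optimum exceeds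
    -- `8 * μ`, or some small family covering at most an eighth of `U` catches all requests in `U`.
    -- Each term dominates the indicator of its event.
    have hpoint : ∀ A : Fin k → Fin n, (1 : ℝ) ≤
        1 / ((M : ℝ) + 1) * (meeting Γ U (opt A)).card + 1 / (8 * μ) * optCost Γ w A +
          ∑ G ∈ 𝒢, if ∀ r, A r ∈ Uᶜ ∪ V G then (1 : ℝ) else 0 := by
      intro A
      have hO : 0 ≤ optCost Γ w A := by
        rw [← hopt]; exact Finset.sum_nonneg fun j _ => hw j
      have hS : 0 ≤ ∑ G ∈ 𝒢, if ∀ r, A r ∈ Uᶜ ∪ V G then (1 : ℝ) else 0 :=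
        Finset.sum_nonneg fun G _ => by split_ifs <;> norm_num
      have hN' : 0 ≤ 1 / ((M : ℝ) + 1) * (meeting Γ U (opt A)).card := by positivity
      have hO' : 0 ≤ 1 / (8 * μ) * optCost Γ w A := by positivity
      rcases lt_or_ge M (meeting Γ U (opt A)).card with h1 | h1
      · have : (1 : ℝ) ≤ 1 / ((M : ℝ) + 1) * (meeting Γ U (opt A)).card := by
          rw [one_div, inv_mul_eq_div, le_div_iff₀ (by positivity), one_mul]
          exact_mod_cast h1
        linarith
      rcases lt_or_ge (8 * μ) (optCost Γ w A) with h2 | h2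
      · have : (1 : ℝ) ≤ 1 / (8 * μ) * optCost Γ w A := by
          rw [one_div, inv_mul_eq_div, le_div_iff₀ (by positivity), one_mul]
          exact h2.le
        linarith
      have hmemG : meeting Γ U (opt A) ∈ 𝒢 := by
        refine mem_filter.2 ⟨mem_univ _, h1, ?_⟩
        have hterm : ∀ j ∈ meeting Γ U (opt A),
            ((Γ j ∩ U).card : ℝ) ≤ U.card / (64 * μ) * w j := by
          intro j hj
          have hne := (mem_filter.1 hj).2
          have hc : (0 : ℝ) < (Γ j ∩ U).card := by exact_mod_cast hne.card_pos
          have h := hineff j hne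
          rw [costEff, div_lt_div_iff₀ hu0 hc] at h
          rw [div_mul_eq_mul_div, le_div_iff₀ (by positivity)]
          linarith
        calc ((V (meeting Γ U (opt A))).card : ℝ)
            ≤ ∑ j ∈ meeting Γ U (opt A), ((Γ j ∩ U).card : ℝ) := by
              exact_mod_cast Finset.card_biUnion_le
          _ ≤ ∑ j ∈ meeting Γ U (opt A), U.card / (64 * μ) * w j := Finset.sum_le_sum hterm
          _ = U.card / (64 * μ) * ∑ j ∈ meeting Γ U (opt A), w j := by rw [Finset.mul_sum]
          _ ≤ U.card / (64 * μ) * (8 * μ) := by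
              gcongr
              refine le_trans ?_ ((hopt A).le.trans h2)
              exact Finset.sum_le_sum_of_subset_of_nonneg (filter_subset _ _)
                fun j _ _ => hw j
          _ = U.card / 8 := by field_simp; ring
      have hall : ∀ r, A r ∈ Uᶜ ∪ V (meeting Γ U (opt A)) := by
        intro r
        by_cases hr : A r ∈ U
        · obtain ⟨j, hj, hjr⟩ := hmem A r hr
          exact mem_union_right _ (mem_biUnion.2 ⟨j, hj, mem_inter.2 ⟨hjr, hr⟩⟩)
        · exact mem_union_left _ (mem_compl.2 hr)
      have hone : (1 : ℝ) ≤ ∑ G ∈ 𝒢, if ∀ r, A r ∈ Uᶜ ∪ V G then (1 : ℝ) else 0 := by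
        refine le_trans ?_ (Finset.single_le_sum (f := fun G =>
          if ∀ r, A r ∈ Uᶜ ∪ V G then (1 : ℝ) else 0)
          (fun G _ => by split_ifs <;> norm_num) hmemG)
        simp only [if_pos hall, le_refl]
      linarith
    have hprob : ∀ G ∈ 𝒢, expectArrival n k
        (fun A => if ∀ r, A r ∈ Uᶜ ∪ V G then (1 : ℝ) else 0) ≤ Real.exp (-(7 / 8 * κ)) := by
      intro G hG
      have hVG := (mem_filter.1 hG).2.2
      have hcompl : ((Uᶜ.card : ℕ) : ℝ) = n - U.card := by
        rw [Finset.card_compl, Fintype.card_fin, Nat.cast_sub]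
        simpa using Finset.card_le_univ U
      have hle : ((Uᶜ ∪ V G).card : ℝ) / n ≤ 1 - 7 / 8 * p := by
        have h : ((Uᶜ ∪ V G).card : ℝ) ≤ Uᶜ.card + (V G).card := by
          exact_mod_cast Finset.card_union_le _ _
        rw [div_le_iff₀ hn0]
        have : (1 - 7 / 8 * p) * n = n - 7 / 8 * U.card := by rw [hp]; field_simp
        linarith
      rw [expectArrival_forall_mem]
      calc (((Uᶜ ∪ V G).card : ℝ) / n) ^ k ≤ (1 - 7 / 8 * p) ^ k :=
            pow_le_pow_left₀ (by positivity) hle k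
        _ ≤ Real.exp (-(k * (7 / 8 * p))) := one_sub_pow_le_exp_neg_mul (by linarith) k
        _ = Real.exp (-(7 / 8 * κ)) := by rw [hκ]; ring_nf
    have hcard𝒢 : (𝒢.card : ℝ) ≤ Real.exp (κ / 4) := by
      have h1 : 𝒢.card ≤ (l + 1) ^ M :=
        (Finset.card_le_card (fun G hG => mem_filter.2
          ⟨mem_univ _, (mem_filter.1 hG).2.1⟩)).trans (card_filter_card_le l M)
      calc (𝒢.card : ℝ) ≤ ((l : ℝ) + 1) ^ M := by exact_mod_cast h1
        _ = Real.exp (M * Real.log (l + 1)) := by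
            rw [Real.exp_nat_mul, Real.exp_log (by positivity)]
        _ ≤ Real.exp (κ / 4) := Real.exp_le_exp.2 hMle
    have hsum : ∑ G ∈ 𝒢, expectArrival n k
        (fun A => if ∀ r, A r ∈ Uᶜ ∪ V G then (1 : ℝ) else 0) ≤ 8 / 13 := by
      calc _ ≤ 𝒢.card • Real.exp (-(7 / 8 * κ)) := Finset.sum_le_card_nsmul _ _ _ hprob
        _ ≤ Real.exp (κ / 4) * Real.exp (-(7 / 8 * κ)) := by
            rw [nsmul_eq_mul]; gcongr
        _ = Real.exp (-(5 / 8 * κ)) := by rw [← Real.exp_add]; ring_nf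
        _ ≤ Real.exp (-(5 / 8)) := Real.exp_le_exp.2 (by linarith)
        _ ≤ 1 / (1 + 5 / 8) := exp_neg_le_inv_one_add (by norm_num)
        _ = 8 / 13 := by norm_num
    have hexp := expectArrival_mono hpoint
    rw [expectArrival_const hn, expectArrival_add, expectArrival_add, expectArrival_const_mul,
      expectArrival_const_mul, expectArrival_sum, ← hEN] at hexp
    have hmarkov : 1 / (8 * μ) * expectArrival n k (fun A => optCost Γ w A) = 1 / 8 := by
      change 1 / (8 * μ) * μ = 1 / 8
      field_simp
    rw [hmarkov] at hexp
    -- The other two terms have expectation at most `1 / 8` and `8 / 13`, and `1 - 1 / 8 - 8 / 13 =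
    -- 27 / 104 > 1 / 4`.
    have h4 : 1 / 4 ≤ 1 / ((M : ℝ) + 1) * EN := by linarith
    rw [one_div_mul_eq_div, le_div_iff₀ (by positivity)] at h4
    nlinarith

end Optimum

/-! ### Amortized analysis of the selection loop -/

section Run

variable {n l k : ℕ}

/-- The total cost of the pairs of `L` that serve the requested tasks lying in `U`. -/
noncomputable def costWithin (Γ : Fin l → Finset (Fin n)) (w : Fin l → ℝ) (U : Finset (Fin n))
    (L : List (Fin l)) (A : Fin k → Fin n) : ℝ :=
  ∑ j ∈ univ.filter (fun j => ∃ r : Fin k, A r ∈ U ∧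
    L.find? (fun j' => decide (A r ∈ Γ j')) = some j), w j

lemma costWithin_univ (Γ : Fin l → Finset (Fin n)) (w : Fin l → ℝ) (L : List (Fin l))
    (A : Fin k → Fin n) : costWithin Γ w univ L A = socialCost Γ w L A := by
  simp [costWithin, socialCost, winningSet]

lemma costWithin_cons_le (Γ : Fin l → Finset (Fin n)) {w : Fin l → ℝ} (hw : ∀ j, 0 ≤ w j)
    (U : Finset (Fin n)) (j : Fin l) (L : List (Fin l)) (A : Fin k → Fin n) :
    costWithin Γ w U (j :: L) A ≤
      w j * (if ∃ r, A r ∈ Γ j ∩ U then 1 else 0) + costWithin Γ w (U \ Γ j) L A := by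
  classical
  set S := univ.filter (fun i => ∃ r : Fin k, A r ∈ U \ Γ j ∧
    L.find? (fun j' => decide (A r ∈ Γ j')) = some i) with hS
  set S' := univ.filter (fun i => ∃ r : Fin k, A r ∈ U ∧
    (j :: L).find? (fun j' => decide (A r ∈ Γ j')) = some i) with hS'
  have key : ∀ i ∈ S', (i = j ∧ ∃ r, A r ∈ Γ j ∩ U) ∨ i ∈ S := by
    intro i hi
    obtain ⟨r, hr, hf⟩ := (mem_filter.1 hi).2
    by_cases hj : A r ∈ Γ j
    · rw [List.find?_cons_of_pos (by simpa using hj)] at hf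
      exact Or.inl ⟨(Option.some.inj hf).symm, r, mem_inter.2 ⟨hj, hr⟩⟩
    · rw [List.find?_cons_of_neg (by simpa using hj)] at hf
      exact Or.inr (mem_filter.2 ⟨mem_univ _, r, mem_sdiff.2 ⟨hr, hj⟩, hf⟩)
  change ∑ i ∈ S', w i ≤ _ + ∑ i ∈ S, w i
  split_ifs with h
  · have hsub : S' ⊆ {j} ∪ S := by
      intro i hi
      rcases key i hi with ⟨rfl, -⟩ | h'
      · simp
      · exact mem_union_right _ h'
    calc ∑ i ∈ S', w i ≤ ∑ i ∈ {j} ∪ S, w i :=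
          Finset.sum_le_sum_of_subset_of_nonneg hsub fun i _ _ => hw i
      _ ≤ ∑ i ∈ {j} ∪ S, w i + ∑ i ∈ {j} ∩ S, w i :=
          le_add_of_nonneg_right (Finset.sum_nonneg fun i _ => hw i)
      _ = w j * 1 + ∑ i ∈ S, w i := by rw [Finset.sum_union_inter]; simp
  · have hsub : S' ⊆ S := fun i hi => (key i hi).resolve_left fun h' => h h'.2
    rw [mul_zero, zero_add]
    exact Finset.sum_le_sum_of_subset_of_nonneg hsub fun i _ _ => hw i

lemma expectArrival_costWithin_cons_le (hn : 1 ≤ n) (Γ : Fin l → Finset (Fin n)) {w : Fin l → ℝ}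
    (hw : ∀ j, 0 ≤ w j) (U : Finset (Fin n)) (j : Fin l) (L : List (Fin l)) :
    expectArrival n k (costWithin Γ w U (j :: L)) ≤
      w j * min 1 ((k : ℝ) * (Γ j ∩ U).card / n) +
        expectArrival n k (costWithin Γ w (U \ Γ j) L) := by
  refine (expectArrival_mono (costWithin_cons_le Γ hw U j L)).trans ?_
  rw [expectArrival_add, expectArrival_const_mul]
  gcongr
  · exact hw j
  refine le_min ?_ (expectArrival_exists_mem_le hn _)
  refine le_trans (expectArrival_mono fun A => ?_) (expectArrival_const (k := k) hn 1).le
  split_ifs <;> norm_num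

/-- An upper bound of the harmonic number `H s`. -/
noncomputable def logPotential (s : ℕ) : ℝ :=
  if s = 0 then 0 else 1 + Real.log s

/-- For `d < s` this is `log y ≤ y - 1` at `y = (s - d) / s`. The summand `1`, absent at `s = 0`,
pays for the step that empties `U`. -/
lemma logPotential_add_le {s d : ℕ} (hs : 0 < s) (hd : d ≤ s) :
    logPotential (s - d) + (d : ℝ) / s ≤ logPotential s := by
  have hs' : (0 : ℝ) < s := by exact_mod_cast hs
  rcases hd.eq_or_lt with rfl | hlt
  · have : 0 ≤ Real.log d := Real.log_natCast_nonneg d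
    simp only [logPotential, Nat.sub_self, if_true, hs.ne', if_false, div_self hs'.ne']
    linarith
  · have hsd : s - d ≠ 0 := by omega
    have hpos : (0 : ℝ) < (s : ℝ) - d := by
      have : (d : ℝ) < s := by exact_mod_cast hlt
      linarith
    simp only [logPotential, hsd, hs.ne', if_false, Nat.cast_sub hd]
    have h := Real.log_le_sub_one_of_pos (div_pos hpos hs')
    rw [Real.log_div hpos.ne' hs'.ne', sub_div, div_self hs'.ne'] at h
    linarith

/-- The total excess over `x` of the costs of the sets of `F` that contain a task of `U`. -/
noncomputable def excess (Γ : Fin l → Finset (Fin n)) (w : Fin l → ℝ) (x : ℝ)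
    (U : Finset (Fin n)) (F : Finset (Fin l)) : ℝ :=
  ∑ j ∈ meeting Γ U F, (w j - x)

lemma inter_sdiff_nonempty {Γ : Fin l → Finset (Fin n)} {U : Finset (Fin n)} {i j : Fin l}
    (h : (Γ i ∩ (U \ Γ j)).Nonempty) : (Γ i ∩ U).Nonempty ∧ i ≠ j := by
  obtain ⟨t, ht⟩ := h
  simp only [mem_inter, mem_sdiff] at ht
  refine ⟨⟨t, mem_inter.2 ⟨ht.1, ht.2.1⟩⟩, ?_⟩
  rintro rfl
  exact ht.2.2 ht.1

lemma excess_sdiff_le {Γ : Fin l → Finset (Fin n)} {w : Fin l → ℝ} {x : ℝ} {U : Finset (Fin n)}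
    (hx : ∀ i, (Γ i ∩ U).Nonempty → x ≤ w i) (j : Fin l) (F : Finset (Fin l)) :
    excess Γ w x (U \ Γ j) F ≤ excess Γ w x U F := by
  refine Finset.sum_le_sum_of_subset_of_nonneg ?_ fun i hi _ => ?_
  · intro i hi
    exact mem_filter.2 ⟨(mem_filter.1 hi).1, (inter_sdiff_nonempty (mem_filter.1 hi).2).1⟩
  · linarith [hx i (mem_filter.1 hi).2]

lemma excess_eq_add (Γ : Fin l → Finset (Fin n)) (w : Fin l → ℝ) (x y : ℝ) (U : Finset (Fin n))
    (F : Finset (Fin l)) :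
    excess Γ w x U F = excess Γ w y U F + (y - x) * (meeting Γ U F).card := by
  simp only [excess, Finset.sum_sub_distrib, Finset.sum_const, nsmul_eq_mul]
  ring

lemma card_sdiff_eq (U V : Finset (Fin n)) : (U \ V).card = U.card - (V ∩ U).card := by
  rw [Finset.card_sdiff]

/-- The right side is a potential for induction along the run. The level `x`, a lower bound for the
prices of all useful pairs, is raised at type II steps; `x * κ(U)` prepays later type II costs, and
the excess finances raising `x`. -/
lemma expectArrival_costWithin_le (hn : 1 ≤ n) (hl : 2 ≤ l)
    {Γ : Fin l → Finset (Fin n)} {w : Fin l → ℝ} (hw : ∀ j, 0 ≤ w j)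
    {opt : (Fin k → Fin n) → Finset (Fin l)} (hcov : ∀ A r, ∃ j ∈ opt A, A r ∈ Γ j)
    (hopt : ∀ A, ∑ j ∈ opt A, w j = optCost Γ w A) (hμ : 0 < expectedOpt Γ w k)
    {U : Finset (Fin n)} {Q : Finset (Fin l)} {L : List (Fin l)}
    (hrun : IsRun Γ w (64 * expectedOpt Γ w k) U Q L)
    (hQ : ∀ j, (Γ j ∩ U).Nonempty → j ∈ Q) {x : ℝ} (hx0 : 0 ≤ x)
    (hx : ∀ j, (Γ j ∩ U).Nonempty → x ≤ w j) :
    expectArrival n k (costWithin Γ w U L) ≤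
      64 * expectedOpt Γ w k * logPotential U.card + x * (k * U.card / n) +
        16 * Real.log (l + 1) * expectArrival n k (fun A => excess Γ w x U (opt A)) := by
  have hK : 0 ≤ 16 * Real.log ((l : ℝ) + 1) :=
    mul_nonneg (by norm_num) (Real.log_nonneg (by linarith [Nat.cast_nonneg (α := ℝ) l]))
  induction hrun generalizing x with
  | done Q =>
    simp [costWithin, logPotential, excess, meeting, expectArrival]
  | @step U Q j L hU hsel _ ih =>
    have hQ' : ∀ i, (Γ i ∩ (U \ Γ j)).Nonempty → i ∈ Q.erase j := fun i hi =>
      mem_erase.2 ⟨(inter_sdiff_nonempty hi).2, hQ i (inter_sdiff_nonempty hi).1⟩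
    have hu0 : (0 : ℝ) < U.card := by exact_mod_cast hU.card_pos
    have hcle : (Γ j ∩ U).card ≤ U.card := Finset.card_le_card inter_subset_right
    have hcard : ((U \ Γ j).card : ℝ) = U.card - (Γ j ∩ U).card := by
      rw [card_sdiff_eq, Nat.cast_sub hcle]
    have hpot := logPotential_add_le hU.card_pos hcle
    rw [← card_sdiff_eq] at hpot
    have hcons := expectArrival_costWithin_cons_le (k := k) hn Γ hw U j L
    rcases hsel with ⟨⟨⟨-, hne⟩, heff⟩, -⟩ | ⟨hnone, ⟨-, hne⟩, hmin⟩
    -- Type I: `x` is kept, and the full price `w j` is covered by the drop of the logarithmic term.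
    · have hc : (0 : ℝ) < (Γ j ∩ U).card := by exact_mod_cast hne.card_pos
      have hwj : w j ≤ 64 * expectedOpt Γ w k * ((Γ j ∩ U).card / U.card) := by
        rw [costEff, div_le_iff₀ hc] at heff
        calc w j ≤ _ := heff
          _ = _ := by ring
      have h1 := ih hQ' hx0 fun i hi => hx i (inter_sdiff_nonempty hi).1
      have h2 : expectArrival n k (fun A => excess Γ w x (U \ Γ j) (opt A)) ≤
          expectArrival n k (fun A => excess Γ w x U (opt A)) :=
        expectArrival_mono fun A => excess_sdiff_le hx j _
      have h3 : w j * min 1 (k * ((Γ j ∩ U).card : ℝ) / n) ≤ w j :=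
        mul_le_of_le_one_right (hw j) (min_le_left _ _)
      have h4 : x * (k * ((U \ Γ j).card : ℝ) / n) ≤ x * (k * U.card / n) := by
        gcongr
        exact sdiff_subset
      have h5 := mul_le_mul_of_nonneg_left hpot (by positivity : 0 ≤ 64 * expectedOpt Γ w k)
      have h6 := mul_le_mul_of_nonneg_left h2 hK
      rw [mul_add] at h5
      linarith
    -- Type II: `x` is raised to `w j`. The increase `(w j - x) * κ(U)` is covered by the drop in
    -- excess via `hkey`; the expected cost of `j` is then covered by the shrinking of `U`.
    · have hmin' : ∀ i, (Γ i ∩ U).Nonempty → w j ≤ w i := fun i hi => hmin i ⟨hQ i hi, hi⟩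
      have hineff : ∀ i, (Γ i ∩ U).Nonempty →
          64 * expectedOpt Γ w k / (U.card : ℝ) < costEff Γ w U i := fun i hi =>
        lt_of_not_ge fun h => hnone ⟨i, ⟨hQ i hi, hi⟩, h⟩
      have hkey := mul_card_div_le_expectArrival_card_meeting hn hl hw hcov hopt hμ hU hineff
      have h1 := ih hQ' (hw j) fun i hi => hmin' i (inter_sdiff_nonempty hi).1
      have h2 : expectArrival n k (fun A => excess Γ w (w j) (U \ Γ j) (opt A)) ≤
          expectArrival n k (fun A => excess Γ w (w j) U (opt A)) :=
        expectArrival_mono fun A => excess_sdiff_le hmin' j _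
      have h3 : w j * min 1 (k * ((Γ j ∩ U).card : ℝ) / n) ≤
          w j * (k * (Γ j ∩ U).card / n) :=
        mul_le_mul_of_nonneg_left (min_le_right _ _) (hw j)
      have h4 : w j * (k * ((U \ Γ j).card : ℝ) / n) =
          w j * (k * U.card / n) - w j * (k * (Γ j ∩ U).card / n) := by
        rw [hcard]; ring
      have hpot' : logPotential (U \ Γ j).card ≤ logPotential U.card := by
        have : (0 : ℝ) ≤ (Γ j ∩ U).card / U.card := by positivity
        linarith
      have h5 := mul_le_mul_of_nonneg_left hpot' (by positivity : 0 ≤ 64 * expectedOpt Γ w k)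
      have h6 := mul_le_mul_of_nonneg_left h2 hK
      have h7 : expectArrival n k (fun A => excess Γ w x U (opt A)) =
          expectArrival n k (fun A => excess Γ w (w j) U (opt A)) +
            (w j - x) * expectArrival n k (fun A => ((meeting Γ U (opt A)).card : ℝ)) := by
        rw [← expectArrival_const_mul, ← expectArrival_add]
        congr 1
        funext A
        exact excess_eq_add Γ w x (w j) U (opt A)
      have h8 := mul_le_mul_of_nonneg_left hkey (sub_nonneg.2 (hx j hne))
      rw [h7]
      nlinarith

lemma costRatio_le (hn : 1 ≤ n) (hl : 2 ≤ l) (hk : 1 ≤ k)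
    {Γ : Fin l → Finset (Fin n)} (hΓ : ∀ t, ∃ j, t ∈ Γ j)
    {w : Fin l → ℝ} (hw : ∀ j, 1 ≤ w j) {L : List (Fin l)}
    (hrun : IsRun Γ w (64 * expectedOpt Γ w k) univ univ L) :
    costRatio Γ w L k ≤ 160 * Real.log ((l : ℝ) * n) := by
  choose opt hcov hopt using fun A : Fin k → Fin n => exists_optCost_eq hΓ w A
  have hw0 : ∀ j, 0 ≤ w j := fun j => by linarith [hw j]
  have hμ : 0 < expectedOpt Γ w k := by linarith [one_le_expectedOpt hn hΓ hw hk]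
  -- The level starts at `x = 0`, where the excess is at most the optimal cost.
  have h := expectArrival_costWithin_le hn hl hw0 hcov hopt hμ hrun (fun j _ => mem_univ j)
    le_rfl fun j _ => hw0 j
  have hL : costWithin Γ w univ L = socialCost (k := k) Γ w L :=
    funext fun A => costWithin_univ Γ w L A
  have hexc : expectArrival n k (fun A => excess Γ w 0 univ (opt A)) ≤ expectedOpt Γ w k := by
    refine expectArrival_mono fun A => ?_
    rw [← hopt]
    simp only [excess, sub_zero]
    exact Finset.sum_le_sum_of_subset_of_nonneg (filter_subset _ _) fun j _ _ => hw0 j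
  have hl2 : (2 : ℝ) ≤ l := by exact_mod_cast hl
  have hn1 : (1 : ℝ) ≤ n := by exact_mod_cast hn
  have hlog2 : 1 / 2 ≤ Real.log l :=
    (by linarith [Real.log_two_gt_d9] : (1 : ℝ) / 2 ≤ Real.log 2).trans
      (Real.log_le_log (by norm_num) hl2)
  have hlogn : 0 ≤ Real.log n := Real.log_nonneg hn1
  have hlogl : Real.log (l + 1) ≤ 2 * Real.log l := by
    have h2 : 2 * Real.log (l : ℝ) = Real.log ((l : ℝ) ^ 2) := by simp [Real.log_pow]
    rw [h2]
    exact Real.log_le_log (by positivity) (by nlinarith)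
  have hlogl0 : 0 ≤ Real.log ((l : ℝ) + 1) := Real.log_nonneg (by linarith)
  have hpot : logPotential (univ : Finset (Fin n)).card = 1 + Real.log n := by
    rw [Finset.card_univ, Fintype.card_fin, logPotential, if_neg (by omega)]
  rw [hL, hpot, zero_mul, add_zero] at h
  rw [costRatio, div_le_iff₀ hμ, Real.log_mul (by positivity) (by positivity)]
  have h1 : 16 * Real.log ((l : ℝ) + 1) * expectArrival n k (fun A => excess Γ w 0 univ (opt A)) ≤
      16 * Real.log ((l : ℝ) + 1) * expectedOpt Γ w k :=
    mul_le_mul_of_nonneg_left hexc (by positivity)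
  -- Source of 160: `64 ≤ 128 log l` as `log l ≥ 1 / 2`, and `16 log (l + 1) ≤ 32 log l`.
  have h2 : 64 * (1 + Real.log n) + 16 * Real.log ((l : ℝ) + 1) ≤
      160 * (Real.log l + Real.log n) := by linarith
  have h3 := mul_le_mul_of_nonneg_right h2 hμ.le
  linarith

end Run

/-! ### Averaging over matching results -/

section Average

variable {n m l : ℕ}

lemma matchingProb_pos (hm : 1 ≤ m) (u : ℝ → ℝ) (Δ ε : ℝ) (c : Fin m → ℝ) (P : Fin l → Fin m) :
    0 < matchingProb u Δ ε c P := by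
  have : Nonempty (Fin m) := ⟨⟨0, hm⟩⟩
  exact Finset.prod_pos fun j _ => div_pos (Real.exp_pos _)
    (Finset.sum_pos (fun i _ => Real.exp_pos _) univ_nonempty)

lemma competitiveRatio_le (hm : 1 ≤ m) (u : ℝ → ℝ) (Δ ε : ℝ) (Γ : Fin l → Finset (Fin n))
    (c : Fin m → ℝ) (run : ℕ → (Fin l → Fin m) → List (Fin l)) {F : Finset (Fin l → Fin m)}
    (hF : F.Nonempty) {B : ℝ}
    (hB : ∀ k, 1 ≤ k → ∀ P, costRatio Γ (fun j => c (P j)) (run k P) k ≤ B) :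
    competitiveRatio u Δ ε Γ c run F ≤ (B : EReal) := by
  refine iSup₂_le fun k hk => EReal.coe_le_coe_iff.2 ?_
  have hpos : 0 < ∑ P ∈ F, matchingProb u Δ ε c P :=
    Finset.sum_pos (fun P _ => matchingProb_pos hm u Δ ε c P) hF
  rw [expectedRatio, div_le_iff₀ hpos, Finset.mul_sum]
  refine Finset.sum_le_sum fun P _ => ?_
  rw [mul_comm B]
  exact mul_le_mul_of_nonneg_left (hB k hk P) (matchingProb_pos hm u Δ ε c P).le

end Average

end Herald

theorem theorem5 :
    ∃ C : ℝ, 0 < C ∧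
      ∀ (n m l : ℕ), 1 ≤ n → 1 ≤ m →
      -- the task subsets; each task lies in at least two of them
      ∀ Γ : Fin l → Finset (Fin n),
        (∀ t : Fin n, ∃ j₁ j₂ : Fin l, j₁ ≠ j₂ ∧ t ∈ Γ j₁ ∧ t ∈ Γ j₂) →
      -- the workers' costs, which are also their bids
      ∀ (bmax : ℝ) (c : Fin m → ℝ), (∀ i, c i ∈ Set.Icc 1 bmax) →
      -- score function, sensitivity and privacy parameter of the exponential mechanism
      ∀ (u : ℝ → ℝ) (Δ ε : ℝ), 0 < Δ → 0 < ε →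
      ∀ run : ℕ → (Fin l → Fin m) → List (Fin l), Herald.IsWinningSelection Γ c run →
        Herald.competitiveRatio u Δ ε Γ c run Finset.univ
            ≤ ((C * Real.log ((l : ℝ) * (n : ℝ)) : ℝ) : EReal) ∧
        ((Herald.adequateMatchings Γ m).Nonempty →
          Herald.competitiveRatio u Δ ε Γ c run (Herald.adequateMatchings Γ m)
            ≤ ((C * Real.log ((l : ℝ) * (n : ℝ)) : ℝ) : EReal)) := by
  refine ⟨160, by norm_num, ?_⟩
  intro n m l hn hm Γ hΓ bmax c hc u Δ ε _ _ run hrun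
  have hcov : ∀ t, ∃ j, t ∈ Γ j := fun t =>
    let ⟨j, _, _, hj, _⟩ := hΓ t
    ⟨j, hj⟩
  have hl : 2 ≤ l := by
    obtain ⟨j₁, j₂, hne, -, -⟩ := hΓ ⟨0, hn⟩
    have := Fin.val_ne_of_ne hne
    omega
  have hB : ∀ k, 1 ≤ k → ∀ P, Herald.costRatio Γ (fun j => c (P j)) (run k P) k ≤
      160 * Real.log ((l : ℝ) * (n : ℝ)) := fun k hk P =>
    Herald.costRatio_le hn hl hk hcov (fun j => (hc (P j)).1) (hrun k hk P)
  have hne : (Finset.univ : Finset (Fin l → Fin m)).Nonempty := ⟨fun _ => ⟨0, hm⟩, mem_univ _⟩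
  exact ⟨Herald.competitiveRatio_le hm u Δ ε Γ c run hne hB,
    fun hF => Herald.competitiveRatio_le hm u Δ ε Γ c run hF hB⟩
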